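/- For a positive integer $n$ let $T_n=\left[\frac{2}{1+2(i-j)}\right]_{i,j=1}^n$. For $A=[a_{ij}]\in\mathbb R^{n\times n}$ and $1\le p,q\le\infty$ put $$\|A\|_p=\Big(\sum_{i,j=1}^n|a_{ij}|^p\Big)^{1/p},\qquad \|A\|_{p,q}=\Big(\sum_{j=1}^n\Big(\sum_{i=1}^n|a_{ij}|^p\Big)^{q/p}\Big)^{1/q},$$ with the usual maxima when an exponent is $\infty$ and with $n^{-1/\infty}=1$. Put $B(p)=4\left(\frac12+\frac1{2^p-1}\right)^{1/p}$ for $1\le p<\infty$ and $B(\infty)=\lim_{p\to\infty}B(p)=4$. **Theorem.** The equation $$\Big(1-\frac1{2^\mu}\Big)\zeta(\mu)=2^{\mu-1}\Big(\frac12+\frac1{2^\mu-1}\Big)$$ has a unique root $\mu$ in $(1,\infty)$, and $\mu=1.6181\ldots$ (that is, $1.6181\le\mu<1.6182$). For $1<p<\mu$ there is a unique positive integer $N=N_{1,p}$ with $$N^{-1/p}\|T_N\|_p<B(p)\le (N+1)^{-1/p}\|T_{N+1}\|_p,$$ and there is a positive integer $N=N_{2,p}$ with $$N^{-1}\|T_N\|_{p,1}\le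 B(p)\le (N+1)^{-1}\|T_{N+1}\|_{p,1}.$$ Moreover, for every choice of such integers $N_{2,p}$ the following holds. We have $N_{1,p}\ge 7$ for $1<p<\mu$. If $1<p<\mu$ and $N_{1,p}<n\le N_{2,p}$, the equation $n^{-1/q}\|T_n\|_{p,q}=B(p)$ has a unique root $q=\eta_{p,n}$ in $[1,\infty]$, and $1\le\eta_{p,n}\le p$. Let $n\ge1$ and $1\le q\le p\le\infty$. Then $$n^{-1/q}\|T_n\|_{p,q}<4\Big(\frac12+\frac1{2^p-1}\Big)^{1/p}$$ (the right-hand side being read as $4$ for $p=\infty$) holds in each of the following cases: - $p=1$ and $n\le 7$; - $p\ge\mu$; - $1<p<\mu$ and $n\le N_{1,p}$; - $1<p<\mu$, $N_{1,p}<n\le N_{2,p}$ and $q<\eta_{p,n}$. For all other values of $n,p,q$ (with $n\ge1$, $1\le q\le p\le\infty$) the opposite inequality $n^{-1/q}\|T_n\|_{p,q}\ge 4\left(\frac12+\frac1{2^p-1}\right)^{1/p}$ holds. -/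

import Mathlib

open scoped ENNReal

noncomputable section

namespace CauchyToeplitz

/-- The Cauchy--Toeplitz matrix `T_n = [2 / (1 + 2 (i - j))]`, `i, j = 1, …, n`. Only the difference
`i - j` enters, so the rows and columns may be numbered from `0`. -/
def T (n : ℕ) : Matrix (Fin n) (Fin n) ℝ :=
  Matrix.of fun i j => 2 / (1 + 2 * ((i : ℝ) - (j : ℝ)))

/-- The entrywise `ℓ_p` norm `‖A‖_p = (∑_{i,j} |a_{ij}|^p)^{1/p}`
(the maximum of the `|a_{ij}|` if `p = ∞`). -/
def lpNorm {n : ℕ} (p : ℝ≥0∞) (A : Matrix (Fin n) (Fin n) ℝ) : ℝ :=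
  ‖(WithLp.toLp p (fun ij : Fin n × Fin n => A ij.1 ij.2) : PiLp p fun _ => ℝ)‖

/-- The mixed norm `‖A‖_{p,q} = (∑_j (∑_i |a_{ij}|^p)^{q/p})^{1/q}`: the `ℓ_q` norm of the vector of
the `ℓ_p` norms of the columns (with the usual maxima if `p = ∞` or `q = ∞`). -/
def lpqNorm {n : ℕ} (p q : ℝ≥0∞) (A : Matrix (Fin n) (Fin n) ℝ) : ℝ :=
  ‖(WithLp.toLp q (fun j : Fin n =>
      ‖(WithLp.toLp p (fun i : Fin n => A i j) : PiLp p fun _ => ℝ)‖) : PiLp q fun _ => ℝ)‖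

/-- `n^{-1/p} ‖T_n‖_p` -/
def scaledLp (p : ℝ≥0∞) (n : ℕ) : ℝ :=
  (n : ℝ) ^ (-(1 / p).toReal) * lpNorm p (T n)

/-- `n^{-1/q} ‖T_n‖_{p,q}`, where `n^{-1/∞} = 1`. -/
def scaledLpq (p q : ℝ≥0∞) (n : ℕ) : ℝ :=
  (n : ℝ) ^ (-(1 / q).toReal) * lpqNorm p q (T n)

/-- `4 (1/2 + 1/(2^p - 1))^{1/p}`, which is `4` for `p = ∞` (the limit as `p → ∞`). -/
def bound (p : ℝ≥0∞) : ℝ :=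
  if p = ∞ then 4
  else 4 * (1 / 2 + 1 / ((2 : ℝ) ^ p.toReal - 1)) ^ (1 / p.toReal)

/-- `μ > 1` solves `(1 - 1/2^μ) ζ(μ) = 2^{μ-1} (1/2 + 1/(2^μ - 1))`, with the Riemann zeta function
(the equation is read in `ℂ`). -/
def IsThreshold (μ : ℝ) : Prop :=
  1 < μ ∧
    ((1 - 1 / (2 : ℝ) ^ μ : ℝ) : ℂ) * riemannZeta (μ : ℂ) =
      (((2 : ℝ) ^ (μ - 1) * (1 / 2 + 1 / ((2 : ℝ) ^ μ - 1)) : ℝ) : ℂ)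

/-- `N` is the positive integer at which `n^{-1/p} ‖T_n‖_p` is last below the bound. -/
def IsN₁ (p : ℝ≥0∞) (N : ℕ) : Prop :=
  0 < N ∧ scaledLp p N < bound p ∧ bound p ≤ scaledLp p (N + 1)

/-- `N` is a positive integer at which `n^{-1} ‖T_n‖_{p,1}` passes the bound. -/
def IsN₂ (p : ℝ≥0∞) (N : ℕ) : Prop :=
  0 < N ∧ scaledLpq p 1 N ≤ bound p ∧ bound p ≤ scaledLpq p 1 (N + 1)

end CauchyToeplitz

end

open CauchyToeplitz

open scoped ENNReal

namespace CauchyToeplitz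

/-! For finite p, the column of `T n` with index j has ℓ_p norm `(2^p (S(j) + S(n-j)))^{1/p}`, where
`S = oddSum p` sums `(2k+1)^{-p}`. The scaled mixed norm is the power mean of order q of these
column norms. The bound has the same shape, `(2^p · 2 R)^{1/p}` with `R = thresholdRhs p`
(`bound_eq`). Since S increases to `oddZeta p = (1 - 2^{-p}) ζ(p)` for p > 1, everything depends on
comparing `oddZeta p` with R, and their difference changes sign exactly once, at μ.

If μ ≤ p < ∞, every column norm is below the bound, hence so is every power mean. For p = ∞ all
column norms are 2, while the bound is 4. If 1 < p < μ, a long matrix has mostly columns above the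
bound, so even the mean of order 1 passes it (`exists_bound_le_scaledLpq_one`).

Two monotonicities then settle all cases. The mean increases with q, strictly for n ≥ 3 and finite p
(`scaledLpq_strictMono_exponent`), and it does not decrease with n when p and q are finite
(`scaledLpq_le_succ`). So for 1 < p < μ the order p mean stays below the bound up to `N₁`, the order
1 mean is at least the bound beyond `N₂`, and in between a unique exponent η gives equality, by
continuity in q. The value 7 comes from evaluating the order p mean at n = 7 against the minimum of
R; p = 1 is settled by direct evaluation at n = 7 and n = 8. -/

/-- The power mean `((1/n) ∑ u_j^s)^{1/s}`. -/
noncomputable def powMean {n : ℕ} (u : Fin n → ℝ) (s : ℝ) : ℝ :=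
  ((n : ℝ)⁻¹ * ∑ j, u j ^ s) ^ (1 / s)

/-! ### Power means: monotonicity in the exponent and in the length. -/

section PowMean

variable {n : ℕ} {u : Fin n → ℝ} {s t L : ℝ}

lemma mean_rpow_pos (hn : 0 < n) (hu : ∀ j, 0 < u j) (s : ℝ) :
    0 < (n : ℝ)⁻¹ * ∑ j, u j ^ s := by
  have : Nonempty (Fin n) := ⟨⟨0, hn⟩⟩
  have h : 0 < ∑ j, u j ^ s :=
    Finset.sum_pos (fun j _ => Real.rpow_pos_of_pos (hu j) s) Finset.univ_nonempty
  positivity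

lemma powMean_strictMono (hn : 0 < n) (hu : ∀ j, 0 < u j) (hne : ∃ i j, u i ≠ u j)
    (hs : 0 < s) (hst : s < t) : powMean u s < powMean u t := by
  have ht : 0 < t := hs.trans hst
  have hr : 1 < t / s := (one_lt_div hs).2 hst
  have hn' : (0 : ℝ) < n := by exact_mod_cast hn
  obtain ⟨i, j, hij⟩ := hne
  -- Strict Jensen for `x ↦ x^(t/s)` at the points `u j ^ s`, with equal weights.
  have key := (strictConvexOn_rpow hr).map_sum_lt (t := Finset.univ)
    (w := fun _ : Fin n => (n : ℝ)⁻¹) (p := fun j => u j ^ s)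
    (fun _ _ => by positivity) (by simp [hn'.ne'])
    (fun j _ => (Real.rpow_pos_of_pos (hu j) s).le)
    ⟨i, Finset.mem_univ _, j, Finset.mem_univ _, fun h => hij <|
      (Real.rpow_left_inj (hu i).le (hu j).le hs.ne').1 h⟩
  simp only [smul_eq_mul, ← Finset.mul_sum] at key
  have h2 : ∀ j, (u j ^ s) ^ (t / s) = u j ^ t := fun j => by
    rw [← Real.rpow_mul (hu j).le, mul_div_cancel₀ _ hs.ne']
  simp only [h2] at key
  have h3 := Real.rpow_lt_rpow (Real.rpow_nonneg (mean_rpow_pos hn hu s).le _) key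
    (show 0 < 1 / t by positivity)
  rw [← Real.rpow_mul (mean_rpow_pos hn hu s).le,
    show t / s * (1 / t) = 1 / s by field_simp] at h3
  exact h3

lemma powMean_mono (hn : 0 < n) (hu : ∀ j, 0 < u j) (hs : 0 < s) (hst : s ≤ t) :
    powMean u s ≤ powMean u t := by
  rcases hst.eq_or_lt with rfl | hst
  · rfl
  by_cases hne : ∃ i j, u i ≠ u j
  · exact (powMean_strictMono hn hu hne hs hst).le
  · push Not at hne
    have hn' : (n : ℝ) ≠ 0 := by exact_mod_cast hn.ne'
    have h : ∀ r : ℝ, 0 < r → powMean u r = u ⟨0, hn⟩ := fun r hr => by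
      unfold powMean
      rw [Finset.sum_congr rfl fun j _ => by rw [hne j ⟨0, hn⟩]]
      simp only [Finset.sum_const, Finset.card_univ, Fintype.card_fin, nsmul_eq_mul]
      rw [inv_mul_cancel_left₀ hn', ← Real.rpow_mul (hu _).le, mul_one_div_cancel hr.ne',
        Real.rpow_one]
    rw [h s hs, h t (hs.trans hst)]

lemma continuousOn_powMean (hn : 0 < n) (hu : ∀ j, 0 < u j) :
    ContinuousOn (powMean u) (Set.Ioi 0) := by
  unfold powMean
  refine ContinuousOn.rpow ?_ ?_ fun s _ => Or.inl (mean_rpow_pos hn hu s).ne'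
  · refine continuousOn_const.mul (continuousOn_finsetSum _ fun j _ => ?_)
    exact continuousOn_const.rpow continuousOn_id fun s _ => Or.inl (hu j).ne'
  · exact continuousOn_const.div continuousOn_id fun s hs => ne_of_gt hs

lemma powMean_lt (hn : 0 < n) (hu : ∀ j, 0 < u j) (hs : 0 < s) (hL : ∀ j, u j < L) :
    powMean u s < L := by
  have : Nonempty (Fin n) := ⟨⟨0, hn⟩⟩
  have hn' : (0 : ℝ) < n := by exact_mod_cast hn
  have hL0 : 0 < L := (hu ⟨0, hn⟩).trans (hL _)
  have h1 : ∑ j, u j ^ s < ∑ _j : Fin n, L ^ s :=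
    Finset.sum_lt_sum_of_nonempty Finset.univ_nonempty fun j _ =>
      Real.rpow_lt_rpow (hu j).le (hL j) hs
  have h2 : (n : ℝ)⁻¹ * ∑ j, u j ^ s < L ^ s := by
    simp only [Finset.sum_const, Finset.card_univ, Fintype.card_fin, nsmul_eq_mul] at h1
    rwa [inv_mul_lt_iff₀ hn']
  have h3 := Real.rpow_lt_rpow (mean_rpow_pos hn hu s).le h2 (show 0 < 1 / s by positivity)
  rwa [← Real.rpow_mul hL0.le, mul_one_div_cancel hs.ne', Real.rpow_one] at h3

lemma powMean_le (hn : 0 < n) (hu : ∀ j, 0 < u j) (hs : 0 < s) (hL : ∀ j, u j ≤ L) :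
    powMean u s ≤ L :=
  le_of_forall_gt fun _ hc => powMean_lt hn hu hs fun j => (hL j).trans_lt hc

/-- If every entry of `v` is dominated by both of its neighbours in the longer vector `w`, then
the mean of `v` is at most that of `w`. -/
lemma mean_le_mean_succ {v : Fin n → ℝ} {w : Fin (n + 1) → ℝ} (hn : 0 < n)
    (h₁ : ∀ j, v j ≤ w j.castSucc) (h₂ : ∀ j, v j ≤ w j.succ) :
    (n : ℝ)⁻¹ * ∑ j, v j ≤ ((n + 1 : ℕ) : ℝ)⁻¹ * ∑ j, w j := by
  have : Nonempty (Fin n) := ⟨⟨0, hn⟩⟩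
  have hn' : (0 : ℝ) < n := by exact_mod_cast hn
  obtain ⟨m, hm⟩ := Finite.exists_max v
  have hsum : ∑ j, v j + v m ≤ ∑ j, w j := by
    -- Deleting the entry of `w` at the position of the maximum of `v` leaves entries that dominate
    -- `v` one by one; the deleted entry is at least `v m`, hence at least the mean of `v`.
    rw [Fin.sum_univ_succAbove w m.castSucc, add_comm]
    refine add_le_add (h₁ m) (Finset.sum_le_sum fun j _ => ?_)
    rw [Fin.succAbove]
    split_ifs
    exacts [h₁ j, h₂ j]
  have hmean : ∑ j, v j ≤ n * v m := by
    have := Finset.sum_le_sum fun j (_ : j ∈ Finset.univ) => hm j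
    simpa using this
  rw [inv_mul_le_iff₀ hn', ← mul_assoc, mul_comm (n : ℝ), mul_assoc,
    le_inv_mul_iff₀ (by positivity)]
  push_cast
  nlinarith

lemma powMean_le_powMean_succ {v : Fin n → ℝ} {w : Fin (n + 1) → ℝ} (hn : 0 < n) (hs : 0 < s)
    (hv : ∀ j, 0 < v j) (h₁ : ∀ j, v j ≤ w j.castSucc) (h₂ : ∀ j, v j ≤ w j.succ) :
    powMean v s ≤ powMean w s :=
  Real.rpow_le_rpow (mean_rpow_pos hn hv s).le
    (mean_le_mean_succ hn (fun j => Real.rpow_le_rpow (hv j).le (h₁ j) hs.le)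
      fun j => Real.rpow_le_rpow (hv j).le (h₂ j) hs.le) (by positivity)

end PowMean

/-! ### The sum over odd integers and the right-hand side of the threshold equation. -/

section OddZeta

/-- `∑_{k < m} (2k+1)^{-r}` -/
noncomputable def oddSum (r : ℝ) (m : ℕ) : ℝ := ∑ k ∈ Finset.range m, ((2 * k + 1 : ℕ) : ℝ) ^ (-r)

/-- `∑_k (2k+1)^{-r}` -/
noncomputable def oddZeta (r : ℝ) : ℝ := ∑' k : ℕ, ((2 * k + 1 : ℕ) : ℝ) ^ (-r)

/-- The right-hand side `2^{r-1} (1/2 + 1/(2^r-1))` of the equation for the threshold. -/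
noncomputable def thresholdRhs (r : ℝ) : ℝ :=
  (2 : ℝ) ^ (r - 1) * (1 / 2 + 1 / ((2 : ℝ) ^ r - 1))

variable {r s : ℝ}

lemma summable_nat_rpow_neg (hr : 1 < r) : Summable fun k : ℕ => (k : ℝ) ^ (-r) :=
  Real.summable_nat_rpow.2 (by linarith)

lemma summable_odd_rpow_neg (hr : 1 < r) : Summable fun k : ℕ => ((2 * k + 1 : ℕ) : ℝ) ^ (-r) :=
  (summable_nat_rpow_neg hr).comp_injective fun a b h => by simpa using h

lemma odd_rpow_pos (r : ℝ) (k : ℕ) : 0 < ((2 * k + 1 : ℕ) : ℝ) ^ r :=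
  Real.rpow_pos_of_pos (by positivity) r

lemma oddSum_strictMono (r : ℝ) : StrictMono (oddSum r) :=
  strictMono_nat_of_lt_succ fun m => by
    rw [oddSum, oddSum, Finset.sum_range_succ]
    linarith [odd_rpow_pos (-r) m]

lemma oddSum_nonneg (r : ℝ) (m : ℕ) : 0 ≤ oddSum r m :=
  Finset.sum_nonneg fun k _ => (odd_rpow_pos (-r) k).le

lemma oddSum_le_of_le (m : ℕ) (h : r ≤ s) : oddSum s m ≤ oddSum r m :=
  Finset.sum_le_sum fun k _ =>
    Real.rpow_le_rpow_of_exponent_le (by norm_cast; omega) (neg_le_neg h)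

lemma tendsto_oddSum (hr : 1 < r) :
    Filter.Tendsto (oddSum r) Filter.atTop (nhds (oddZeta r)) :=
  (summable_odd_rpow_neg hr).hasSum.tendsto_sum_nat

lemma oddSum_lt_oddZeta (hr : 1 < r) (m : ℕ) : oddSum r m < oddZeta r :=
  (oddSum_strictMono r (Nat.lt_succ_self m)).trans_le
    ((oddSum_strictMono r).monotone.ge_of_tendsto (tendsto_oddSum hr) _)

lemma oddZeta_strictAnti (hr : 1 < r) (h : r < s) : oddZeta s < oddZeta r := by
  refine Summable.tsum_lt_tsum (i := 1) (fun k => ?_) ?_ (summable_odd_rpow_neg (hr.trans h))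
    (summable_odd_rpow_neg hr)
  · exact Real.rpow_le_rpow_of_exponent_le (by norm_cast; omega) (neg_le_neg h.le)
  · exact Real.rpow_lt_rpow_of_exponent_lt (by norm_num) (neg_lt_neg h)

lemma ofReal_tsum_rpow_neg (hr : 1 < r) :
    ((∑' k : ℕ, (k : ℝ) ^ (-r) : ℝ) : ℂ) = riemannZeta r := by
  rw [zeta_eq_tsum_one_div_nat_cpow (by simpa using hr), Complex.ofReal_tsum]
  refine tsum_congr fun k => ?_
  rw [Complex.ofReal_cpow (by positivity), Complex.ofReal_neg, Complex.cpow_neg, one_div,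
    Complex.ofReal_natCast]

/-- The even terms of the zeta series add up to `2^{-r} ζ(r)`. -/
lemma ofReal_oddZeta (hr : 1 < r) :
    (oddZeta r : ℂ) = ((1 - 1 / (2 : ℝ) ^ r : ℝ) : ℂ) * riemannZeta r := by
  have hev : ∀ k : ℕ, ((2 * k : ℕ) : ℝ) ^ (-r) = (2 : ℝ) ^ (-r) * (k : ℝ) ^ (-r) := fun k => by
    push_cast
    exact Real.mul_rpow (by norm_num) (by positivity)
  have h := tsum_even_add_odd (f := fun k : ℕ => (k : ℝ) ^ (-r))
    (by simpa only [hev] using (summable_nat_rpow_neg hr).mul_left _) (summable_odd_rpow_neg hr)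
  simp only [hev, tsum_mul_left] at h
  rw [← ofReal_tsum_rpow_neg hr, ← Complex.ofReal_mul]
  congr 1
  rw [oddZeta, one_div, ← Real.rpow_neg (by norm_num)]
  linarith

lemma isThreshold_iff {μ : ℝ} : IsThreshold μ ↔ 1 < μ ∧ oddZeta μ = thresholdRhs μ := by
  refine and_congr_right fun h => ?_
  rw [← ofReal_oddZeta h, ← thresholdRhs, Complex.ofReal_inj]

lemma continuousOn_oddZeta : ContinuousOn oddZeta (Set.Ioi 1) := by
  have h : ContinuousOn (fun r : ℝ => (((1 - 1 / (2 : ℝ) ^ r : ℝ) : ℂ) * riemannZeta r).re)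
      (Set.Ioi 1) := by
    refine Complex.continuous_re.comp_continuousOn (ContinuousOn.mul ?_ ?_)
    · refine Continuous.continuousOn (Complex.continuous_ofReal.comp ?_)
      exact continuous_const.sub (continuous_const.div
        (continuous_const.rpow continuous_id fun _ => Or.inl (by norm_num)) fun x => by positivity)
    · intro x hx
      have hx' : (x : ℂ) ≠ 1 := by exact_mod_cast (ne_of_gt hx : x ≠ 1)
      exact ((differentiableAt_riemannZeta hx').continuousAt.comp
        Complex.continuous_ofReal.continuousAt).continuousWithinAt
  refine h.congr fun r hr => ?_
  exact (congrArg Complex.re (ofReal_oddZeta hr))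

lemma one_lt_two_rpow (hr : 0 < r) : (1 : ℝ) < 2 ^ r := Real.one_lt_rpow (by norm_num) hr

lemma thresholdRhs_eq (hr : 0 < r) :
    thresholdRhs r = 2 ^ r / 4 + 1 / 2 + 1 / (2 * ((2 : ℝ) ^ r - 1)) := by
  have := one_lt_two_rpow hr
  have h : (2 : ℝ) ^ r - 1 ≠ 0 := by linarith
  rw [thresholdRhs, Real.rpow_sub (by norm_num), Real.rpow_one]
  field_simp
  ring

lemma thresholdRhs_pos (hr : 0 < r) : 0 < thresholdRhs r := by
  have : 0 < (2 : ℝ) ^ r - 1 := by linarith [one_lt_two_rpow hr]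
  unfold thresholdRhs
  positivity

lemma continuousOn_thresholdRhs : ContinuousOn thresholdRhs (Set.Ioi 1) := by
  have h2 : Continuous fun r : ℝ => (2 : ℝ) ^ r :=
    continuous_const.rpow continuous_id fun _ => Or.inl (by norm_num)
  have h3 : Continuous fun r : ℝ => (2 : ℝ) ^ (r - 1) :=
    continuous_const.rpow (continuous_id.sub continuous_const) fun _ => Or.inl (by norm_num)
  refine h3.continuousOn.mul (continuousOn_const.add (continuousOn_const.div
    (h2.continuousOn.sub continuousOn_const) fun r hr => ?_))
  have := one_lt_two_rpow (zero_lt_one.trans hr)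
  linarith

/-- As a function of `x = 2^r` the expression decreases until `x = 1 + √2` and increases afterwards,
so it is not monotone on `r > 1`. The difference of two values has the sign of `(y-x)((x-1)(y-1) -
2)`, and `x ≥ 2`, `y ≥ 3` make this nonnegative. -/
lemma thresholdRhs_mono (hr : 1 ≤ r) (h : r ≤ s) (hs : (3 : ℝ) ≤ 2 ^ s) :
    thresholdRhs r ≤ thresholdRhs s := by
  have hx : (2 : ℝ) ≤ 2 ^ r := by
    simpa using Real.rpow_le_rpow_of_exponent_le (show (1 : ℝ) ≤ 2 by norm_num) hr
  have hxy : (2 : ℝ) ^ r ≤ 2 ^ s := Real.rpow_le_rpow_of_exponent_le (by norm_num) h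
  rw [thresholdRhs_eq (by linarith), thresholdRhs_eq (by linarith)]
  generalize (2 : ℝ) ^ r = x at *
  generalize (2 : ℝ) ^ s = y at *
  have hx1 : 0 < x - 1 := by linarith
  have hy1 : 0 < y - 1 := by linarith
  have e : y / 4 + 1 / 2 + 1 / (2 * (y - 1)) - (x / 4 + 1 / 2 + 1 / (2 * (x - 1)))
      = (y - x) * ((x - 1) * (y - 1) - 2) / (4 * ((x - 1) * (y - 1))) := by
    field_simp
    ring
  have : 0 ≤ (y - x) * ((x - 1) * (y - 1) - 2) / (4 * ((x - 1) * (y - 1))) :=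
    div_nonneg (mul_nonneg (by linarith) (by nlinarith)) (by positivity)
  linarith

/-- AM-GM in `x - 1` for `x = 2^r`: the difference of the two sides is a square over `2(x-1)`,
vanishing at `x = 1 + √2`. -/
lemma two_mul_thresholdRhs_ge (hr : 0 < r) : 3 / 2 + Real.sqrt 2 ≤ 2 * thresholdRhs r := by
  have h := one_lt_two_rpow hr
  rw [thresholdRhs_eq hr]
  generalize (2 : ℝ) ^ r = x at *
  have hx1 : 0 < x - 1 := by linarith
  have h2 := Real.sq_sqrt (show (0 : ℝ) ≤ 2 by norm_num)
  have e : 2 * (x / 4 + 1 / 2 + 1 / (2 * (x - 1))) - (3 / 2 + Real.sqrt 2)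
      = ((x - 1) - Real.sqrt 2) ^ 2 / (2 * (x - 1)) := by
    rw [sub_sq, h2]
    field_simp
    ring
  have : 0 ≤ ((x - 1) - Real.sqrt 2) ^ 2 / (2 * (x - 1)) := by positivity
  linarith

end OddZeta

/-! ### Two-sided tail estimates for the odd zeta sum. -/

section TailEstimates

variable {p : ℝ}

/-- The function is log-convex: weighted AM-GM is applied once to x, y and once to their powers. -/
lemma convexOn_rpow_neg (hp : 0 ≤ p) : ConvexOn ℝ (Set.Ioi 0) fun x : ℝ => x ^ (-p) := by
  refine ⟨convex_Ioi 0, fun x hx y hy a b ha hb hab => ?_⟩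
  simp only [Set.mem_Ioi] at hx hy
  simp only [smul_eq_mul]
  have h1 := Real.geom_mean_le_arith_mean2_weighted ha hb hx.le hy.le hab
  have h2 := Real.geom_mean_le_arith_mean2_weighted ha hb (Real.rpow_nonneg hx.le (-p))
    (Real.rpow_nonneg hy.le (-p)) hab
  have h3 : (x ^ a * y ^ b) ^ (-p) = (x ^ (-p)) ^ a * (y ^ (-p)) ^ b := by
    rw [Real.mul_rpow (by positivity) (by positivity), ← Real.rpow_mul hx.le, ← Real.rpow_mul hy.le,
      ← Real.rpow_mul hx.le, ← Real.rpow_mul hy.le, mul_comm a, mul_comm b]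
  exact (Real.rpow_le_rpow_of_nonpos (by positivity) h1 (by linarith)).trans (h3 ▸ h2)

lemma integral_rpow_neg (hp : 1 < p) {a b : ℝ} (ha : 0 < a) (hb : 0 < b) :
    ∫ x in a..b, x ^ (-p) = (a ^ (1 - p) - b ^ (1 - p)) / (p - 1) := by
  rw [integral_rpow (Or.inr ⟨by linarith, Set.notMem_uIcc_of_lt ha hb⟩),
    show -p + 1 = 1 - p by ring, ← neg_sub p 1, div_neg, ← neg_div, neg_sub]

lemma intervalIntegrable_rpow_neg {a b : ℝ} (ha : 0 < a) (hb : 0 < b) :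
    IntervalIntegrable (fun x : ℝ => x ^ (-p)) MeasureTheory.volume a b :=
  intervalIntegral.intervalIntegrable_rpow (Or.inr (Set.notMem_uIcc_of_lt ha hb))

/-- The midpoint rule underestimates the integral of `x ^ (-p)`. -/
lemma two_mul_rpow_neg_le (hp : 1 < p) {x : ℝ} (hx : 1 < x) :
    2 * x ^ (-p) ≤ ((x - 1) ^ (1 - p) - (x + 1) ^ (1 - p)) / (p - 1) := by
  rw [← integral_rpow_neg hp (by linarith) (by linarith)]
  have hi := intervalIntegrable_rpow_neg (p := p) (a := x - 1) (b := x + 1) (by linarith)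
    (by linarith)
  -- Averaging the integrand with its reflection about x leaves the integral unchanged, and
  -- convexity bounds the sum pointwise below by `2 * x ^ (-p)`.
  have hrefl : ∫ t in (x - 1)..(x + 1), (2 * x - t) ^ (-p) = ∫ t in (x - 1)..(x + 1), t ^ (-p) := by
    rw [intervalIntegral.integral_comp_sub_left (fun t => t ^ (-p))]
    congr 1 <;> ring
  have hi' : IntervalIntegrable (fun t : ℝ => (2 * x - t) ^ (-p)) MeasureTheory.volume
      (x - 1) (x + 1) := by
    have := (hi.comp_sub_left (2 * x)).symm
    rwa [show 2 * x - (x + 1) = x - 1 by ring, show 2 * x - (x - 1) = x + 1 by ring] at this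
  have h := intervalIntegral.integral_mono_on (a := x - 1) (b := x + 1) (by linarith)
    (g := fun t => t ^ (-p) + (2 * x - t) ^ (-p)) (intervalIntegrable_const (c := 2 * x ^ (-p))) (hi.add hi')
    (fun t ht => by
      have := (convexOn_rpow_neg (show 0 ≤ p by linarith)).2 (x := t) (y := 2 * x - t)
        (Set.mem_Ioi.2 (by linarith [ht.1])) (Set.mem_Ioi.2 (by linarith [ht.2]))
        (show (0 : ℝ) ≤ 1 / 2 by norm_num) (show (0 : ℝ) ≤ 1 / 2 by norm_num) (by norm_num)
      simp only [smul_eq_mul] at this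
      rw [show 1 / 2 * t + 1 / 2 * (2 * x - t) = x by ring] at this
      linarith)
  rw [intervalIntegral.integral_add hi hi', hrefl, intervalIntegral.integral_const, smul_eq_mul] at h
  linarith

/-- The trapezoidal rule overestimates the integral of `x ^ (-p)`. -/
lemma le_rpow_neg_add_rpow_neg (hp : 1 < p) {x : ℝ} (hx : 0 < x) :
    (x ^ (1 - p) - (x + 2) ^ (1 - p)) / (p - 1) ≤ x ^ (-p) + (x + 2) ^ (-p) := by
  rw [← integral_rpow_neg hp hx (by linarith)]
  have hi := intervalIntegrable_rpow_neg (p := p) (a := x) (b := x + 2) hx (by linarith)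
  have h := intervalIntegral.integral_mono_on (a := x) (b := x + 2)
    -- `g` is the chord of the graph over `[x, x + 2]`.
    (g := fun t => x ^ (-p) + (t - x) * (((x + 2) ^ (-p) - x ^ (-p)) / 2)) (by linarith) hi
    (Continuous.intervalIntegrable (by fun_prop) _ _)
    (fun t ht => by
      have := (convexOn_rpow_neg (show 0 ≤ p by linarith)).2 (x := x) (y := x + 2)
        (Set.mem_Ioi.2 hx) (Set.mem_Ioi.2 (by linarith))
        (show (0 : ℝ) ≤ 1 - (t - x) / 2 by linarith [ht.2])
        (show (0 : ℝ) ≤ (t - x) / 2 by linarith [ht.1]) (by ring)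
      simp only [smul_eq_mul] at this
      rw [show (1 - (t - x) / 2) * x + (t - x) / 2 * (x + 2) = t by ring] at this
      linarith)
  refine h.trans_eq ?_
  rw [intervalIntegral.integral_add intervalIntegrable_const
    (Continuous.intervalIntegrable (by fun_prop) _ _), intervalIntegral.integral_const,
    intervalIntegral.integral_mul_const, intervalIntegral.integral_comp_sub_right (fun t => t) x,
    integral_id, smul_eq_mul]
  ring

/-- With the tail replaced by half its integral from `2m`, the approximation decreases in m: one
step is the midpoint rule on `[2m, 2m+2]`. -/
lemma oddZeta_le (hp : 1 < p) {K : ℕ} (hK : 0 < K) :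
    oddZeta p ≤ oddSum p K + ((2 * K : ℕ) : ℝ) ^ (1 - p) / (2 * (p - 1)) := by
  have hp1 : 0 < p - 1 := by linarith
  have hmono : ∀ m, K ≤ m → oddSum p m + ((2 * m : ℕ) : ℝ) ^ (1 - p) / (2 * (p - 1)) ≤
      oddSum p K + ((2 * K : ℕ) : ℝ) ^ (1 - p) / (2 * (p - 1)) := by
    intro m hm
    induction m, hm using Nat.le_induction with
    | base => rfl
    | succ m hm ih =>
      refine le_trans ?_ ih
      have hm1 : (1 : ℝ) ≤ m := by exact_mod_cast (show 1 ≤ m by omega)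
      have h := two_mul_rpow_neg_le hp (x := 2 * m + 1) (by linarith)
      rw [show (2 * m + 1 - 1 : ℝ) = 2 * m by ring,
        show (2 * m + 1 + 1 : ℝ) = 2 * (m + 1) by ring] at h
      rw [oddSum, Finset.sum_range_succ, ← oddSum]
      push_cast
      rw [show ∀ z : ℝ, z / (2 * (p - 1)) = z / (p - 1) / 2 from fun z => by field_simp,
        show ∀ z : ℝ, z / (2 * (p - 1)) = z / (p - 1) / 2 from fun z => by field_simp]
      rw [sub_div] at h
      linarith
  refine le_of_tendsto (tendsto_oddSum hp) (Filter.eventually_atTop.2 ⟨K, fun m hm => ?_⟩)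
  refine le_trans ?_ (hmono m hm)
  have : 0 ≤ ((2 * m : ℕ) : ℝ) ^ (1 - p) / (2 * (p - 1)) := by positivity
  linarith

/-- With the tail replaced by half its integral from `2m+1` plus half its first term, the
approximation increases in m: one step is the trapezoidal rule on `[2m+1, 2m+3]`. The corrections
tend to 0. -/
lemma le_oddZeta (hp : 1 < p) (K : ℕ) :
    oddSum p K + ((2 * K + 1 : ℕ) : ℝ) ^ (1 - p) / (2 * (p - 1)) +
      ((2 * K + 1 : ℕ) : ℝ) ^ (-p) / 2 ≤ oddZeta p := by
  have hmono : ∀ m, K ≤ m → oddSum p K + ((2 * K + 1 : ℕ) : ℝ) ^ (1 - p) / (2 * (p - 1)) +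
      ((2 * K + 1 : ℕ) : ℝ) ^ (-p) / 2 ≤
      oddSum p m + ((2 * m + 1 : ℕ) : ℝ) ^ (1 - p) / (2 * (p - 1)) +
      ((2 * m + 1 : ℕ) : ℝ) ^ (-p) / 2 := by
    intro m hm
    induction m, hm using Nat.le_induction with
    | base => rfl
    | succ m hm ih =>
      refine ih.trans ?_
      have h := le_rpow_neg_add_rpow_neg hp (x := 2 * m + 1) (by positivity)
      rw [show (2 * m + 1 + 2 : ℝ) = 2 * (m + 1) + 1 by ring] at h
      conv_rhs => rw [oddSum, Finset.sum_range_succ, ← oddSum]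
      push_cast
      rw [show ∀ z : ℝ, z / (2 * (p - 1)) = z / (p - 1) / 2 from fun z => by field_simp,
        show ∀ z : ℝ, z / (2 * (p - 1)) = z / (p - 1) / 2 from fun z => by field_simp]
      rw [sub_div] at h
      linarith
  have hcast : Filter.Tendsto (fun m : ℕ => ((2 * m + 1 : ℕ) : ℝ)) Filter.atTop Filter.atTop :=
    tendsto_natCast_atTop_atTop.comp
      (Filter.tendsto_atTop_mono (fun m => by simp only [id]; omega) Filter.tendsto_id)
  have h1 : Filter.Tendsto (fun m : ℕ => ((2 * m + 1 : ℕ) : ℝ) ^ (1 - p)) Filter.atTop (nhds 0) := by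
    have := (tendsto_rpow_neg_atTop (show 0 < p - 1 by linarith)).comp hcast
    simpa only [neg_sub, Function.comp_def] using this
  have h2 : Filter.Tendsto (fun m : ℕ => ((2 * m + 1 : ℕ) : ℝ) ^ (-p)) Filter.atTop (nhds 0) :=
    (tendsto_rpow_neg_atTop (show 0 < p by linarith)).comp hcast
  have hlim := ((tendsto_oddSum hp).add (h1.div_const (2 * (p - 1)))).add (h2.div_const 2)
  rw [zero_div, zero_div, add_zero, add_zero] at hlim
  exact ge_of_tendsto hlim (Filter.eventually_atTop.2 ⟨K, hmono⟩)

end TailEstimates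

/-! ### Certified decimals locating the threshold. -/

section Numerics

/-- Raising to the power t turns a bound on a rational power into an inequality between natural
numbers. -/
lemma div_le_natCast_rpow_neg {a b n s t : ℕ} (hb : 0 < b) (hn : 0 < n) (ht : 0 < t)
    (h : a ^ t * n ^ s ≤ b ^ t) : (a / b : ℝ) ≤ (n : ℝ) ^ (-(s / t : ℝ)) := by
  have hb' : (0 : ℝ) < b := by exact_mod_cast hb
  have hn' : (0 : ℝ) < n := by exact_mod_cast hn
  have ht' : (t : ℝ) ≠ 0 := by exact_mod_cast ht.ne'
  refine le_of_pow_le_pow_left₀ ht.ne' (by positivity) ?_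
  rw [← Real.rpow_mul_natCast hn'.le, neg_mul, div_mul_cancel₀ _ ht', Real.rpow_neg hn'.le,
    Real.rpow_natCast, div_pow, div_le_iff₀ (by positivity), inv_mul_eq_div,
    le_div_iff₀ (by positivity)]
  exact_mod_cast h

lemma natCast_rpow_neg_le_div {a b n s t : ℕ} (hb : 0 < b) (hn : 0 < n) (ht : 0 < t)
    (h : b ^ t ≤ a ^ t * n ^ s) : (n : ℝ) ^ (-(s / t : ℝ)) ≤ (a / b : ℝ) := by
  have hb' : (0 : ℝ) < b := by exact_mod_cast hb
  have hn' : (0 : ℝ) < n := by exact_mod_cast hn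
  have ht' : (t : ℝ) ≠ 0 := by exact_mod_cast ht.ne'
  refine le_of_pow_le_pow_left₀ ht.ne' (by positivity) ?_
  rw [← Real.rpow_mul_natCast hn'.le, neg_mul, div_mul_cancel₀ _ ht', Real.rpow_neg hn'.le,
    Real.rpow_natCast, div_pow, le_div_iff₀ (by positivity), inv_mul_eq_div,
    div_le_iff₀ (by positivity)]
  exact_mod_cast h

lemma two_rpow_bounds {p l u : ℝ} (hl : 0 < l) (h₁ : l ≤ (2 : ℝ) ^ (-p)) (h₂ : (2 : ℝ) ^ (-p) ≤ u) :
    1 / u ≤ (2 : ℝ) ^ p ∧ (2 : ℝ) ^ p ≤ 1 / l := by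
  have e : (2 : ℝ) ^ p = 1 / 2 ^ (-p) := by rw [Real.rpow_neg (by norm_num), one_div, inv_inv]
  rw [e]
  exact ⟨one_div_le_one_div_of_le (hl.trans_le h₁) h₂, one_div_le_one_div_of_le hl h₁⟩

/-- The point `89/55 = 1.61818...` lies just below 1.6182 and has a small denominator, which keeps
the integer powers manageable. -/
lemma oddZeta_lt_thresholdRhs_numeric : oddZeta (89 / 55) < thresholdRhs (89 / 55) := by
  have upper {n a : ℕ} (hn : 0 < n) (h : (10 ^ 7) ^ 55 ≤ a ^ 55 * n ^ 89) :=
    natCast_rpow_neg_le_div (b := 10 ^ 7) (s := 89) (t := 55) (by norm_num) hn (by norm_num) h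
  have h3 := upper (n := 3) (a := 1690173) (by norm_num) (by norm_num)
  have h5 := upper (n := 5) (a := 739503) (by norm_num) (by norm_num)
  have h7 := upper (n := 7) (a := 429021) (by norm_num) (by norm_num)
  have h9 := upper (n := 9) (a := 285669) (by norm_num) (by norm_num)
  have h11 := upper (n := 11) (a := 206461) (by norm_num) (by norm_num)
  have h13 := upper (n := 13) (a := 157557) (by norm_num) (by norm_num)
  have h15 := upper (n := 15) (a := 124989) (by norm_num) (by norm_num)
  have h17 := upper (n := 17) (a := 102073) (by norm_num) (by norm_num)
  have h19 := upper (n := 19) (a := 85260) (by norm_num) (by norm_num)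
  -- Needed for the tail term `20^(1-p) = 20 · 20^(-p)` with K = 10.
  have h20 := upper (n := 20) (a := 78469) (by norm_num) (by norm_num)
  have hl := div_le_natCast_rpow_neg (a := 3257457) (b := 10 ^ 7) (n := 2) (s := 89) (t := 55)
    (by norm_num) (by norm_num) (by norm_num) (by norm_num)
  have hu := natCast_rpow_neg_le_div (a := 3257458) (b := 10 ^ 7) (n := 2) (s := 89) (t := 55)
    (by norm_num) (by norm_num) (by norm_num) (by norm_num)
  push_cast at h3 h5 h7 h9 h11 h13 h15 h17 h19 h20 hl hu
  -- With the exponent opaque, the powers `n ^ (-p)` are atoms and the final inequality is linear in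
  -- them.
  generalize hp : (89 / 55 : ℝ) = p at *
  have h := oddZeta_le (p := p) (by rw [← hp]; norm_num) (K := 10) (by norm_num)
  have hd : 2 * (p - 1) = 68 / 55 := by rw [← hp]; norm_num
  obtain ⟨h2l, h2u⟩ := two_rpow_bounds (by norm_num) hl hu
  have h2 := one_div_le_one_div_of_le (show 0 < 2 * ((2 : ℝ) ^ p - 1) by norm_num at h2l; linarith)
    (show _ ≤ 2 * (1 / (3257457 / 10 ^ 7) - 1) by linarith)
  rw [hd, sub_eq_add_neg, Real.rpow_add (by norm_num), Real.rpow_one] at h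
  rw [thresholdRhs_eq (by rw [← hp]; norm_num)]
  refine h.trans_lt ?_
  clear h
  simp only [oddSum, Finset.sum_range_succ, Finset.sum_range_zero]
  clear hp
  norm_num at *
  linarith

set_option exponentiation.threshold 20000 in
lemma thresholdRhs_lt_oddZeta_numeric : thresholdRhs 1.6181 < oddZeta 1.6181 := by
  have lower {n a : ℕ} (hn : 0 < n) (h : a ^ 10000 * n ^ 16181 ≤ (10 ^ 7) ^ 10000) :=
    div_le_natCast_rpow_neg (b := 10 ^ 7) (s := 16181) (t := 10000) (by norm_num) hn (by norm_num) h
  have h3 := lower (n := 3) (a := 1690324) (by norm_num) (by norm_num)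
  have h5 := lower (n := 5) (a := 739599) (by norm_num) (by norm_num)
  have h7 := lower (n := 7) (a := 429088) (by norm_num) (by norm_num)
  have h9 := lower (n := 9) (a := 285719) (by norm_num) (by norm_num)
  have h11 := lower (n := 11) (a := 206501) (by norm_num) (by norm_num)
  have h13 := lower (n := 13) (a := 157589) (by norm_num) (by norm_num)
  have h15 := lower (n := 15) (a := 125016) (by norm_num) (by norm_num)
  have h17 := lower (n := 17) (a := 102096) (by norm_num) (by norm_num)
  have h19 := lower (n := 19) (a := 85280) (by norm_num) (by norm_num)
  have h21 := lower (n := 21) (a := 72529) (by norm_num) (by norm_num)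
  have h23 := lower (n := 23) (a := 62601) (by norm_num) (by norm_num)
  have h25 := lower (n := 25) (a := 54700) (by norm_num) (by norm_num)
  have h27 := lower (n := 27) (a := 48295) (by norm_num) (by norm_num)
  have h29 := lower (n := 29) (a := 43022) (by norm_num) (by norm_num)
  have h31 := lower (n := 31) (a := 38621) (by norm_num) (by norm_num)
  have h33 := lower (n := 33) (a := 34905) (by norm_num) (by norm_num)
  have hl := div_le_natCast_rpow_neg (a := 3257642) (b := 10 ^ 7) (n := 2) (s := 16181) (t := 10000)
    (by norm_num) (by norm_num) (by norm_num) (by norm_num)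
  have hu := natCast_rpow_neg_le_div (a := 3257643) (b := 10 ^ 7) (n := 2) (s := 16181) (t := 10000)
    (by norm_num) (by norm_num) (by norm_num) (by norm_num)
  push_cast at h3 h5 h7 h9 h11 h13 h15 h17 h19 h21 h23 h25 h27 h29 h31 h33 hl hu
  rw [show (1.6181 : ℝ) = 16181 / 10000 by norm_num]
  generalize hp : (16181 / 10000 : ℝ) = p at *
  have h := le_oddZeta (p := p) (by rw [← hp]; norm_num) 16
  have hd : 2 * (p - 1) = 6181 / 5000 := by rw [← hp]; norm_num
  obtain ⟨h2l, h2u⟩ := two_rpow_bounds (by norm_num) hl hu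
  have h2 := one_div_le_one_div_of_le
    (show (0 : ℝ) < 2 * (1 / (3257643 / 10 ^ 7) - 1) by norm_num)
    (show _ ≤ 2 * ((2 : ℝ) ^ p - 1) by linarith)
  rw [hd, sub_eq_add_neg, Real.rpow_add (by norm_num), Real.rpow_one] at h
  rw [thresholdRhs_eq (by rw [← hp]; norm_num)]
  refine lt_of_lt_of_le ?_ h
  clear h
  simp only [oddSum, Finset.sum_range_succ, Finset.sum_range_zero]
  clear hp
  norm_num at *
  linarith

end Numerics

/-! ### Existence of the threshold and the single sign change. -/

section Threshold

lemma oddZeta_sub_thresholdRhs_lt {r s : ℝ} (hr : 1 < r) (h : r < s) (hs : (3 : ℝ) ≤ 2 ^ s) :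
    oddZeta s - thresholdRhs s < oddZeta r - thresholdRhs r := by
  linarith [oddZeta_strictAnti hr h, thresholdRhs_mono hr.le h.le hs]

lemma three_le_two_rpow {s : ℝ} (hs : 1.6181 ≤ s) : (3 : ℝ) ≤ 2 ^ s := by
  -- `2^(8/5) ≥ 3` because `2^8 = 256 ≥ 243 = 3^5`.
  refine le_trans ?_ (Real.rpow_le_rpow_of_exponent_le (by norm_num)
    (show (8 / 5 : ℝ) ≤ s by norm_num at hs; linarith))
  refine le_of_pow_le_pow_left₀ (n := 5) (by norm_num) (by positivity) ?_
  rw [← Real.rpow_mul_natCast (by norm_num)]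
  norm_num

lemma exists_threshold :
    ∃ μ : ℝ, 1.6181 ≤ μ ∧ μ < 1.6182 ∧ oddZeta μ = thresholdRhs μ := by
  have hsub : Set.Icc (1.6181 : ℝ) (89 / 55) ⊆ Set.Ioi 1 := fun x hx => by
    have := hx.1
    norm_num at this
    exact Set.mem_Ioi.2 (by linarith)
  have hc : ContinuousOn (fun r => oddZeta r - thresholdRhs r) (Set.Icc 1.6181 (89 / 55)) :=
    (continuousOn_oddZeta.sub continuousOn_thresholdRhs).mono hsub
  obtain ⟨μ, hμ, h⟩ := intermediate_value_Icc' (by norm_num) hc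
    (show (0 : ℝ) ∈ _ from ⟨by linarith [oddZeta_lt_thresholdRhs_numeric],
      by linarith [thresholdRhs_lt_oddZeta_numeric]⟩)
  exact ⟨μ, hμ.1, hμ.2.trans_lt (by norm_num), sub_eq_zero.1 h⟩

end Threshold

/-! ### Column norms and the scaled mixed norm as their power mean. -/

section ColumnNorm

/-- The `ℓ_p` norm of the `j`-th column of `T_n`. -/
noncomputable def columnNorm (p : ℝ≥0∞) (n : ℕ) (j : Fin n) : ℝ :=
  ‖(WithLp.toLp p (fun i : Fin n => T n i j) : PiLp p fun _ => ℝ)‖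

/-- The denominators in a column have absolute values 1, 3, ..., 2j-1 going up from just above the
diagonal, and 1, 3, ..., 2(n-j)-1 going down from the diagonal. -/
lemma sum_abs_entry_rpow (r : ℝ) (n : ℕ) (j : Fin n) :
    ∑ i : Fin n, ‖T n i j‖ ^ r = 2 ^ r * (oddSum r j + oddSum r (n - j)) := by
  obtain ⟨j, hj⟩ := j
  obtain ⟨m, rfl⟩ := Nat.exists_eq_add_of_le hj.le
  have key : ∀ k : ℕ, (2 / ((2 * k + 1 : ℕ) : ℝ)) ^ r = 2 ^ r * ((2 * k + 1 : ℕ) : ℝ) ^ (-r) :=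
    fun k => by
      rw [Real.div_rpow (by norm_num) (by positivity), Real.rpow_neg (by positivity), div_eq_mul_inv]
  simp only [T, Matrix.of_apply]
  rw [Fin.sum_univ_eq_sum_range (fun i : ℕ => ‖(2 : ℝ) / (1 + 2 * ((i : ℝ) - (j : ℝ)))‖ ^ r) (j + m),
    Finset.sum_range_add, ← Finset.sum_range_reflect, mul_add, oddSum, oddSum, Finset.mul_sum,
    Finset.mul_sum, Nat.add_sub_cancel_left]
  congr 1
  · refine Finset.sum_congr rfl fun k hk => ?_
    have hk' : k < j := Finset.mem_range.1 hk
    rw [← key]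
    congr 1
    rw [show ((j - 1 - k : ℕ) : ℝ) = j - 1 - k by
        rw [Nat.cast_sub (by omega), Nat.cast_sub (by omega), Nat.cast_one],
      show (1 + 2 * ((j : ℝ) - 1 - k - j)) = -((2 * k + 1 : ℕ) : ℝ) by push_cast; ring,
      div_neg, norm_neg, Real.norm_of_nonneg (by positivity)]
  · refine Finset.sum_congr rfl fun k _ => ?_
    rw [← key]
    congr 1
    rw [show (1 + 2 * (((j + k : ℕ) : ℝ) - j)) = ((2 * k + 1 : ℕ) : ℝ) by push_cast; ring,
      Real.norm_of_nonneg (by positivity)]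

lemma toReal_pos_of_one_le {p : ℝ≥0∞} (hp : 1 ≤ p) (hp' : p ≠ ∞) : 0 < p.toReal :=
  ENNReal.toReal_pos (zero_lt_one.trans_le hp).ne' hp'

lemma columnNorm_eq {p : ℝ≥0∞} (hp : 1 ≤ p) (hp' : p ≠ ∞) (n : ℕ) (j : Fin n) :
    columnNorm p n j =
      (2 ^ p.toReal * (oddSum p.toReal j + oddSum p.toReal (n - j))) ^ (1 / p.toReal) := by
  rw [columnNorm, PiLp.norm_eq_sum (toReal_pos_of_one_le hp hp')]
  simp only [sum_abs_entry_rpow]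

lemma abs_entry_le_two (n : ℕ) (i j : Fin n) : ‖T n i j‖ ≤ 2 := by
  have h : (1 : ℝ) ≤ |1 + 2 * ((i : ℝ) - (j : ℝ))| := by
    -- The denominator is an odd integer, hence nonzero.
    have hz : (1 : ℤ) ≤ |1 + 2 * ((i : ℤ) - (j : ℤ))| := Int.one_le_abs (by omega)
    exact_mod_cast hz
  rw [T, Matrix.of_apply, norm_div, Real.norm_eq_abs, Real.norm_eq_abs,
    abs_of_nonneg (show (0 : ℝ) ≤ 2 by norm_num)]
  exact div_le_self (by norm_num) h

lemma columnNorm_top (n : ℕ) (j : Fin n) : columnNorm ∞ n j = 2 := by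
  have : Nonempty (Fin n) := ⟨j⟩
  rw [columnNorm, PiLp.norm_eq_ciSup]
  refine le_antisymm (ciSup_le fun i => abs_entry_le_two n i j) ?_
  refine le_trans ?_ (le_ciSup (Set.finite_range _).bddAbove j)
  simp [T]

variable {p q : ℝ≥0∞} {n : ℕ}

lemma oddSum_add_pos (r : ℝ) (j : Fin n) : 0 < oddSum r j + oddSum r (n - j) :=
  add_pos_of_nonneg_of_pos (oddSum_nonneg r _)
    ((oddSum_nonneg r 0).trans_lt (oddSum_strictMono r (Nat.sub_pos_of_lt j.2)))

lemma columnNorm_pos (hp : 1 ≤ p) (j : Fin n) : 0 < columnNorm p n j := by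
  by_cases hp' : p = ∞
  · rw [hp', columnNorm_top]
    norm_num
  · rw [columnNorm_eq hp hp']
    exact Real.rpow_pos_of_pos (mul_pos (by positivity) (oddSum_add_pos _ j)) _

lemma columnNorm_le_columnNorm (hp : 1 ≤ p) (hp' : p ≠ ∞) {m : ℕ} {i : Fin n} {j : Fin m}
    (h : oddSum p.toReal i + oddSum p.toReal (n - i) ≤
      oddSum p.toReal j + oddSum p.toReal (m - j)) : columnNorm p n i ≤ columnNorm p m j := by
  rw [columnNorm_eq hp hp', columnNorm_eq hp hp']
  exact Real.rpow_le_rpow (mul_nonneg (by positivity) (oddSum_add_pos _ i).le)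
    (mul_le_mul_of_nonneg_left h (by positivity)) (by positivity)

lemma scaledLpq_eq_powMean (hp : 1 ≤ p) (hq : 1 ≤ q) (hq' : q ≠ ∞) :
    scaledLpq p q n = powMean (columnNorm p n) q.toReal := by
  have hq0 := toReal_pos_of_one_le hq hq'
  have h0 : 0 ≤ ∑ j, columnNorm p n j ^ q.toReal :=
    Finset.sum_nonneg fun j _ => Real.rpow_nonneg (columnNorm_pos hp j).le _
  rw [scaledLpq, lpqNorm, PiLp.norm_eq_sum hq0, powMean, Real.mul_rpow (by positivity) h0,
    one_div q, ENNReal.toReal_inv, Real.rpow_neg (by positivity), one_div,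
    Real.inv_rpow (by positivity)]
  congr 2
  refine Finset.sum_congr rfl fun j _ => ?_
  change ‖columnNorm p n j‖ ^ q.toReal = _
  rw [Real.norm_of_nonneg (columnNorm_pos hp j).le]

lemma scaledLpq_top (hp : 1 ≤ p) : scaledLpq p ∞ n = ⨆ j, columnNorm p n j := by
  rw [scaledLpq, lpqNorm, PiLp.norm_eq_ciSup]
  change (n : ℝ) ^ (-(1 / ∞).toReal) * ⨆ j, ‖columnNorm p n j‖ = _
  simp only [Real.norm_of_nonneg (columnNorm_pos hp _).le]
  simp

lemma scaledLp_eq_scaledLpq (hp : 1 ≤ p) (hp' : p ≠ ∞) : scaledLp p n = scaledLpq p p n := by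
  have hp0 := toReal_pos_of_one_le hp hp'
  rw [scaledLp, scaledLpq, lpNorm, lpqNorm, PiLp.norm_eq_sum hp0, PiLp.norm_eq_sum hp0]
  congr 2
  rw [Fintype.sum_prod_type_right]
  refine Finset.sum_congr rfl fun j _ => ?_
  change ∑ i, ‖T n i j‖ ^ p.toReal = ‖columnNorm p n j‖ ^ p.toReal
  rw [Real.norm_of_nonneg (columnNorm_pos hp j).le, columnNorm, PiLp.norm_eq_sum hp0, ← Real.rpow_mul
    (Finset.sum_nonneg fun i _ => Real.rpow_nonneg (norm_nonneg _) _),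
    one_div_mul_cancel hp0.ne', Real.rpow_one]

/-- Each column norm of `T n` is at most those of columns j and j+1 of `T (n + 1)`: enlarging the
matrix lengthens one of the two odd sums. -/
lemma scaledLpq_le_succ (hp : 1 ≤ p) (hp' : p ≠ ∞) (hq : 1 ≤ q) (hq' : q ≠ ∞) (hn : 0 < n) :
    scaledLpq p q n ≤ scaledLpq p q (n + 1) := by
  rw [scaledLpq_eq_powMean hp hq hq', scaledLpq_eq_powMean hp hq hq']
  have hmono := (oddSum_strictMono p.toReal).monotone
  refine powMean_le_powMean_succ hn (toReal_pos_of_one_le hq hq') (columnNorm_pos hp)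
    (fun j => columnNorm_le_columnNorm hp hp' ?_) fun j => columnNorm_le_columnNorm hp hp' ?_
  · exact add_le_add le_rfl (hmono (by simp only [Fin.val_castSucc]; omega))
  · exact add_le_add (hmono (by simp)) (hmono (by simp only [Fin.val_succ]; omega))

lemma scaledLpq_mono_size (hp : 1 ≤ p) (hp' : p ≠ ∞) (hq : 1 ≤ q) (hq' : q ≠ ∞) {m : ℕ}
    (hm : 0 < m) (h : m ≤ n) : scaledLpq p q m ≤ scaledLpq p q n := by
  induction n, h using Nat.le_induction with
  | base => rfl
  | succ n hn ih => exact ih.trans (scaledLpq_le_succ hp hp' hq hq' (hm.trans_le hn))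

lemma exists_columnNorm_ne (hp : 1 ≤ p) (hp' : p ≠ ∞) (hn : 3 ≤ n) :
    ∃ i j, columnNorm p n i ≠ columnNorm p n j := by
  have hp0 := toReal_pos_of_one_le hp hp'
  -- Passing from column 0 to column 1 trades the term `(2n-1)^(-p) < 1` for a second term 1.
  refine ⟨⟨0, by omega⟩, ⟨1, by omega⟩, ne_of_lt ?_⟩
  rw [columnNorm_eq hp hp', columnNorm_eq hp hp']
  refine Real.rpow_lt_rpow (mul_nonneg (by positivity) (oddSum_add_pos _ _).le)
    (mul_lt_mul_of_pos_left ?_ (by positivity)) (by positivity)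
  obtain ⟨m, rfl⟩ : ∃ m, n = m + 1 := ⟨n - 1, by omega⟩
  have hm : (1 : ℝ) < ((2 * m + 1 : ℕ) : ℝ) := by exact_mod_cast (by omega : 1 < 2 * m + 1)
  have h1 := Real.rpow_lt_one_of_one_lt_of_neg hm (neg_lt_zero.2 hp0)
  simp only [Nat.sub_zero, Nat.add_sub_cancel]
  rw [oddSum, oddSum, oddSum, oddSum, Finset.sum_range_succ _ m]
  simp only [Finset.sum_range_zero, Finset.sum_range_one]
  norm_num at h1 ⊢
  linarith

lemma scaledLpq_strictMono_exponent (hp : 1 ≤ p) (hp' : p ≠ ∞) (hn : 3 ≤ n) (hq : 1 ≤ q)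
    {q' : ℝ≥0∞} (h : q < q') : scaledLpq p q n < scaledLpq p q' n := by
  have hn0 : 0 < n := by omega
  have hq_top : q ≠ ∞ := h.ne_top
  have hq0 := toReal_pos_of_one_le hq hq_top
  rw [scaledLpq_eq_powMean hp hq hq_top]
  have hne := exists_columnNorm_ne hp hp' hn
  by_cases hq' : q' = ∞
  · rw [hq', scaledLpq_top hp]
    refine (powMean_strictMono hn0 (columnNorm_pos hp) hne hq0 (lt_add_one _)).trans_le ?_
    exact powMean_le hn0 (columnNorm_pos hp) (by linarith)
      fun j => le_ciSup (Set.finite_range _).bddAbove j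
  · rw [scaledLpq_eq_powMean hp (hq.trans h.le) hq']
    exact powMean_strictMono hn0 (columnNorm_pos hp) hne hq0
      ((ENNReal.toReal_lt_toReal hq_top hq').2 h)

lemma scaledLpq_mono_exponent (hp : 1 ≤ p) (hn : 0 < n) (hq : 1 ≤ q)
    {q' : ℝ≥0∞} (h : q ≤ q') (hq' : q' ≠ ∞) : scaledLpq p q n ≤ scaledLpq p q' n := by
  have hq_top : q ≠ ∞ := ne_top_of_le_ne_top hq' h
  rw [scaledLpq_eq_powMean hp hq hq_top, scaledLpq_eq_powMean hp (hq.trans h) hq']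
  exact powMean_mono hn (columnNorm_pos hp) (toReal_pos_of_one_le hq hq_top)
    ((ENNReal.toReal_le_toReal hq_top hq').2 h)

end ColumnNorm

/-! ### Comparison of the means with the bound. -/

section Bound

variable {p q : ℝ≥0∞} {n : ℕ}

lemma bound_eq (hp : 1 ≤ p) (hp' : p ≠ ∞) :
    bound p = (2 ^ p.toReal * (2 * thresholdRhs p.toReal)) ^ (1 / p.toReal) := by
  have hr := toReal_pos_of_one_le hp hp'
  rw [bound, if_neg hp']
  generalize p.toReal = r at *
  have h1 : 0 < (2 : ℝ) ^ r - 1 := by linarith [one_lt_two_rpow hr]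
  rw [show (2 : ℝ) ^ r * (2 * thresholdRhs r) = 4 ^ r * (1 / 2 + 1 / ((2 : ℝ) ^ r - 1)) by
      rw [thresholdRhs, Real.rpow_sub (by norm_num), Real.rpow_one,
        show (4 : ℝ) = 2 * 2 by norm_num, Real.mul_rpow (by norm_num) (by norm_num)]
      ring,
    Real.mul_rpow (by positivity) (by positivity), ← Real.rpow_mul (by norm_num),
    mul_one_div_cancel hr.ne', Real.rpow_one]

lemma two_rpow_mul_rpow_lt {r x y : ℝ} (hr : 0 < r) (hx : 0 ≤ x) (h : x < y) :
    (2 ^ r * x) ^ (1 / r) < (2 ^ r * y) ^ (1 / r) :=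
  Real.rpow_lt_rpow (by positivity) (mul_lt_mul_of_pos_left h (by positivity)) (by positivity)

lemma scaledLpq_lt_bound_of_oddZeta_le (hp : 1 < p) (hp' : p ≠ ∞) (hn : 0 < n) (hq : 1 ≤ q)
    (hq' : q ≠ ∞) (h : oddZeta p.toReal ≤ thresholdRhs p.toReal) :
    scaledLpq p q n < bound p := by
  have hr : 1 < p.toReal := by
    simpa using (ENNReal.toReal_lt_toReal ENNReal.one_ne_top hp').2 hp
  rw [scaledLpq_eq_powMean hp.le hq hq', bound_eq hp.le hp']
  refine powMean_lt hn (columnNorm_pos hp.le) (toReal_pos_of_one_le hq hq') fun j => ?_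
  rw [columnNorm_eq hp.le hp']
  refine two_rpow_mul_rpow_lt (by linarith) (oddSum_add_pos _ j).le ?_
  linarith [oddSum_lt_oddZeta hr j, oddSum_lt_oddZeta hr (n - j)]

lemma scaledLpq_top_lt_bound (hn : 0 < n) (hq : 1 ≤ q) : scaledLpq ∞ q n < bound ∞ := by
  have : Nonempty (Fin n) := ⟨⟨0, hn⟩⟩
  rw [bound, if_pos rfl]
  by_cases hq' : q = ∞
  · rw [hq', scaledLpq_top le_top]
    simp only [columnNorm_top, ciSup_const]
    norm_num
  · rw [scaledLpq_eq_powMean le_top hq hq']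
    exact powMean_lt hn (columnNorm_pos le_top) (toReal_pos_of_one_le hq hq')
      fun j => by rw [columnNorm_top]; norm_num

lemma scaledLpq_self (hp : 1 ≤ p) (hp' : p ≠ ∞) :
    scaledLpq p p n = (2 ^ p.toReal *
      ((n : ℝ)⁻¹ * ∑ j : Fin n, (oddSum p.toReal j + oddSum p.toReal (n - j)))) ^
        (1 / p.toReal) := by
  have hr := toReal_pos_of_one_le hp hp'
  rw [scaledLpq_eq_powMean hp hp hp', powMean, mul_left_comm (2 ^ p.toReal : ℝ),
    Finset.mul_sum _ _ (2 ^ p.toReal : ℝ)]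
  congr 2
  refine Finset.sum_congr rfl fun j _ => ?_
  rw [columnNorm_eq hp hp', ← Real.rpow_mul (mul_nonneg (by positivity) (oddSum_add_pos _ j).le),
    one_div_mul_cancel hr.ne', Real.rpow_one]

lemma oddSum_one (m : ℕ) : oddSum 1 m = ∑ k ∈ Finset.range m, 1 / ((2 * k + 1 : ℕ) : ℝ) :=
  Finset.sum_congr rfl fun k _ => by rw [Real.rpow_neg_one, one_div]

lemma scaledLpq_self_lt_bound (hp : 1 ≤ p) (hp' : p ≠ ∞) (hn : 0 < n) (hn7 : n ≤ 7) :
    scaledLpq p p n < bound p := by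
  refine (scaledLpq_mono_size hp hp' hp hp' hn hn7).trans_lt ?_
  have hr : 1 ≤ p.toReal := by
    simpa using (ENNReal.toReal_le_toReal ENNReal.one_ne_top hp').2 hp
  rw [scaledLpq_self hp hp', bound_eq hp hp']
  refine two_rpow_mul_rpow_lt (by linarith) (mul_nonneg (by positivity)
    (Finset.sum_nonneg fun j _ => (oddSum_add_pos _ j).le)) ?_
  -- The odd sums decrease in p, so their mean for n = 7 is largest at p = 1, where it is below
  -- 2.912; the right-hand side is at least `3/2 + √2 > 2.914` for every p.
  refine lt_of_lt_of_le ?_ (two_mul_thresholdRhs_ge (by linarith))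
  have h1 : ∑ j : Fin 7, (oddSum p.toReal j + oddSum p.toReal (7 - j)) ≤
      ∑ j : Fin 7, (oddSum 1 j + oddSum 1 (7 - j)) :=
    Finset.sum_le_sum fun j _ => add_le_add (oddSum_le_of_le _ hr) (oddSum_le_of_le _ hr)
  have h2 : ∑ j : Fin 7, (oddSum 1 j + oddSum 1 (7 - j)) < 7 * (2.912 : ℝ) := by
    rw [Fin.sum_univ_eq_sum_range (fun j => oddSum 1 j + oddSum 1 (7 - j))]
    simp only [oddSum_one, Finset.sum_range_succ, Finset.sum_range_zero]
    norm_num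
  have h3 : (1.414 : ℝ) < Real.sqrt 2 := Real.lt_sqrt_of_sq_lt (by norm_num)
  norm_num at h2 h3 ⊢
  linarith

lemma bound_one_le_scaledLpq (hn : 8 ≤ n) : bound 1 ≤ scaledLpq 1 1 n := by
  refine le_trans ?_ (scaledLpq_mono_size le_rfl ENNReal.one_ne_top le_rfl ENNReal.one_ne_top
    (show 0 < 8 by norm_num) hn)
  -- At p = 1 the bound equals 6 = 2 · 3.
  have h2 : 8 * (3 : ℝ) ≤ ∑ j : Fin 8, (oddSum 1 j + oddSum 1 (8 - j)) := by
    rw [Fin.sum_univ_eq_sum_range (fun j => oddSum 1 j + oddSum 1 (8 - j))]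
    simp only [oddSum_one, Finset.sum_range_succ, Finset.sum_range_zero]
    norm_num
  rw [scaledLpq_self le_rfl ENNReal.one_ne_top, bound, if_neg ENNReal.one_ne_top]
  norm_num at h2 ⊢
  linarith

/-- If M terms of the odd sum already exceed the threshold value, all columns at distance at least M
from both ends have norm at least some A above the bound. There are N + 1 of these among N + 2M + 1,
so a large N makes the other 2M negligible. -/
lemma exists_bound_le_scaledLpq_one (hp : 1 < p) (hp' : p ≠ ∞)
    (h : thresholdRhs p.toReal < oddZeta p.toReal) : ∃ n, 0 < n ∧ bound p ≤ scaledLpq p 1 n := by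
  have hr : 1 < p.toReal := by
    simpa using (ENNReal.toReal_lt_toReal ENNReal.one_ne_top hp').2 hp
  obtain ⟨M, hM⟩ := ((tendsto_oddSum hr).eventually_const_lt h).exists
  have hA := two_rpow_mul_rpow_lt (r := p.toReal) (x := 2 * thresholdRhs p.toReal)
    (y := oddSum p.toReal M + oddSum p.toReal M) (by linarith)
    (by linarith [thresholdRhs_pos (show 0 < p.toReal by linarith)]) (by linarith)
  rw [← bound_eq hp.le hp'] at hA
  set A := (2 ^ p.toReal * (oddSum p.toReal M + oddSum p.toReal M)) ^ (1 / p.toReal) with hA_def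
  obtain ⟨N, hN⟩ := exists_nat_ge (2 * M * A / (A - bound p))
  rw [div_le_iff₀ (by linarith)] at hN
  refine ⟨N + 2 * M + 1, by omega, ?_⟩
  have hmono := (oddSum_strictMono p.toReal).monotone
  have h0 : 0 ≤ oddSum p.toReal M + oddSum p.toReal M :=
    add_nonneg (oddSum_nonneg _ _) (oddSum_nonneg _ _)
  have hsum : (N + 1) * A ≤ ∑ j, columnNorm p (N + 2 * M + 1) j := by
    simp only [columnNorm_eq hp.le hp']
    rw [Fin.sum_univ_eq_sum_range (fun j => (2 ^ p.toReal * (oddSum p.toReal j +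
      oddSum p.toReal (N + 2 * M + 1 - j))) ^ (1 / p.toReal))]
    have hcard : ∑ _j ∈ Finset.Ico M (N + M + 1), A = (N + 1) * A := by
      rw [Finset.sum_const, Nat.card_Ico, nsmul_eq_mul, show N + M + 1 - M = N + 1 by omega]
      push_cast
      rfl
    rw [← hcard]
    refine (Finset.sum_le_sum fun j hj => ?_).trans (Finset.sum_le_sum_of_subset_of_nonneg
      (fun j hj => Finset.mem_range.2 ?_) fun j _ _ => ?_)
    · rw [Finset.mem_Ico] at hj
      exact Real.rpow_le_rpow (mul_nonneg (by positivity) h0) (mul_le_mul_of_nonneg_left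
        (add_le_add (hmono hj.1) (hmono (by omega))) (by positivity)) (by positivity)
    · rw [Finset.mem_Ico] at hj
      omega
    · exact Real.rpow_nonneg (mul_nonneg (by positivity)
        (add_nonneg (oddSum_nonneg _ _) (oddSum_nonneg _ _))) _
  have hA0 : 0 ≤ A := Real.rpow_nonneg (mul_nonneg (by positivity) h0) _
  rw [scaledLpq_eq_powMean hp.le le_rfl ENNReal.one_ne_top, powMean]
  simp only [ENNReal.toReal_one, Real.rpow_one, div_one]
  rw [le_inv_mul_iff₀ (by positivity)]
  push_cast
  refine le_trans ?_ hsum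
  nlinarith

/-- Existence is the intermediate value theorem on `[1, p]`; uniqueness on all of `[1, ∞]` is strict
monotonicity in the exponent. -/
lemma exists_unique_exponent (hp : 1 ≤ p) (hp' : p ≠ ∞) (hn : 3 ≤ n) {b : ℝ}
    (h₁ : scaledLpq p 1 n ≤ b) (h₂ : b ≤ scaledLpq p p n) :
    ∃ η : ℝ≥0∞, 1 ≤ η ∧ η ≤ p ∧ scaledLpq p η n = b ∧
      ∀ q : ℝ≥0∞, 1 ≤ q → scaledLpq p q n = b → q = η := by
  have hr : 1 ≤ p.toReal := by
    simpa using (ENNReal.toReal_le_toReal ENNReal.one_ne_top hp').2 hp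
  rw [scaledLpq_eq_powMean hp le_rfl ENNReal.one_ne_top, ENNReal.toReal_one] at h₁
  rw [scaledLpq_eq_powMean hp hp hp'] at h₂
  have hc : ContinuousOn (powMean (columnNorm p n)) (Set.Icc 1 p.toReal) :=
    (continuousOn_powMean (by omega) (columnNorm_pos hp)).mono
      fun x hx => zero_lt_one.trans_le hx.1
  obtain ⟨s, hs, hsb⟩ := intermediate_value_Icc hr hc ⟨h₁, h₂⟩
  have hη1 : 1 ≤ ENNReal.ofReal s := by simpa using ENNReal.ofReal_le_ofReal hs.1
  have hηb : scaledLpq p (ENNReal.ofReal s) n = b := by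
    rw [scaledLpq_eq_powMean hp hη1 ENNReal.ofReal_ne_top,
      ENNReal.toReal_ofReal (by linarith [hs.1]), hsb]
  refine ⟨ENNReal.ofReal s, hη1, ENNReal.ofReal_le_of_le_toReal hs.2, hηb, fun q hq hqb => ?_⟩
  rcases lt_trichotomy q (ENNReal.ofReal s) with h | h | h
  · exact absurd (hqb.trans hηb.symm) (scaledLpq_strictMono_exponent hp hp' hn hq h).ne
  · exact h
  · exact absurd (hηb.trans hqb.symm) (scaledLpq_strictMono_exponent hp hp' hn hη1 h).ne

/-- A sequence that starts below `b` and later reaches `b` crosses `b` in a single step. -/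
lemma exists_crossing {f : ℕ → ℝ} {b : ℝ} (h₁ : f 1 < b) (h₂ : ∃ n, 0 < n ∧ b ≤ f n) :
    ∃ N, 0 < N ∧ f N < b ∧ b ≤ f (N + 1) := by
  classical
  have hspec := Nat.find_spec h₂
  have hmin := fun m => Nat.find_min h₂ (m := m)
  generalize Nat.find h₂ = k at *
  have hk : k ≠ 1 := fun hk => by
    subst hk
    linarith [hspec.2]
  refine ⟨k - 1, by omega, ?_, ?_⟩
  · have := hmin (k - 1) (by omega)
    push Not at this
    exact this (by omega)
  · rw [show k - 1 + 1 = k by omega]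
    exact hspec.2

end Bound

end CauchyToeplitz

/-! ### The theorem: assembling the cases. -/

open CauchyToeplitz
theorem theorem3p4 :
    ∃ μ : ℝ,
      -- `μ = 1.6181...` is the unique root
      IsThreshold μ ∧ (∀ ν : ℝ, IsThreshold ν → ν = μ) ∧ 1.6181 ≤ μ ∧ μ < 1.6182 ∧
      -- the integers `N_{1,p}` and `N_{2,p}` exist
      (∀ p : ℝ≥0∞, 1 < p → p < ENNReal.ofReal μ →
        (∃! N : ℕ, IsN₁ p N) ∧ (∃ N : ℕ, IsN₂ p N)) ∧
      ∀ N₁ N₂ : ℝ≥0∞ → ℕ,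
        (∀ p : ℝ≥0∞, 1 < p → p < ENNReal.ofReal μ → IsN₁ p (N₁ p) ∧ IsN₂ p (N₂ p)) →
        (∀ p : ℝ≥0∞, 1 < p → p < ENNReal.ofReal μ → 7 ≤ N₁ p) ∧
        ∃ η : ℝ≥0∞ → ℕ → ℝ≥0∞,
          -- `η_{p,n}` is the unique root of `n^{-1/q} ‖T_n‖_{p,q} = 4 (1/2 + 1/(2^p - 1))^{1/p}`
          (∀ (p : ℝ≥0∞) (n : ℕ), 1 < p → p < ENNReal.ofReal μ → N₁ p < n → n ≤ N₂ p →
            1 ≤ η p n ∧ η p n ≤ p ∧ scaledLpq p (η p n) n = bound p ∧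
              ∀ q : ℝ≥0∞, 1 ≤ q → scaledLpq p q n = bound p → q = η p n) ∧
          ∀ (n : ℕ) (p q : ℝ≥0∞), 0 < n → 1 ≤ q → q ≤ p →
            (((p = 1 ∧ n ≤ 7) ∨
              ENNReal.ofReal μ ≤ p ∨
              (1 < p ∧ p < ENNReal.ofReal μ ∧ n ≤ N₁ p) ∨
              (1 < p ∧ p < ENNReal.ofReal μ ∧ N₁ p < n ∧ n ≤ N₂ p ∧ q < η p n)) →
                scaledLpq p q n < bound p) ∧
            (¬ ((p = 1 ∧ n ≤ 7) ∨
              ENNReal.ofReal μ ≤ p ∨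
              (1 < p ∧ p < ENNReal.ofReal μ ∧ n ≤ N₁ p) ∨
              (1 < p ∧ p < ENNReal.ofReal μ ∧ N₁ p < n ∧ n ≤ N₂ p ∧ q < η p n)) →
                bound p ≤ scaledLpq p q n) := by
  obtain ⟨μ, hμl, hμu, hμ⟩ := exists_threshold
  have hμ1 : 1 < μ := by
    norm_num at hμl
    linarith
  have hne_top : ∀ p : ℝ≥0∞, p < ENNReal.ofReal μ → p ≠ ∞ := fun p h => h.ne_top
  have hbelow : ∀ p : ℝ≥0∞, 1 < p → p < ENNReal.ofReal μ →
      thresholdRhs p.toReal < oddZeta p.toReal := fun p h1 h2 => by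
    have hr : 1 < p.toReal := by
      simpa using (ENNReal.toReal_lt_toReal ENNReal.one_ne_top (hne_top p h2)).2 h1
    have hrμ : p.toReal < μ := ENNReal.toReal_lt_of_lt_ofReal h2
    linarith [oddZeta_sub_thresholdRhs_lt hr hrμ (three_le_two_rpow hμl)]
  have habove : ∀ p : ℝ≥0∞, p ≠ ∞ → ENNReal.ofReal μ ≤ p →
      oddZeta p.toReal ≤ thresholdRhs p.toReal := fun p h1 h2 => by
    have hμr : μ ≤ p.toReal := (ENNReal.ofReal_le_iff_le_toReal h1).1 h2
    rcases hμr.eq_or_lt with h | h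
    · rw [← h, hμ]
    · linarith [oddZeta_sub_thresholdRhs_lt hμ1 h (three_le_two_rpow (hμl.trans h.le))]
  refine ⟨μ, isThreshold_iff.2 ⟨hμ1, hμ⟩, fun ν hν => ?_, hμl, hμu, fun p hp hpμ => ?_,
    fun N₁ N₂ hN => ?_⟩
  · obtain ⟨hν1, hν⟩ := isThreshold_iff.1 hν
    rcases lt_trichotomy ν μ with h | h | h
    · linarith [oddZeta_sub_thresholdRhs_lt hν1 h (three_le_two_rpow hμl)]
    · exact h
    · linarith [oddZeta_sub_thresholdRhs_lt hμ1 h (three_le_two_rpow (hμl.trans h.le))]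
  · have hp' := hne_top p hpμ
    obtain ⟨n, hn, hbn⟩ := exists_bound_le_scaledLpq_one hp hp' (hbelow p hp hpμ)
    have h1 : scaledLpq p p 1 < bound p :=
      scaledLpq_self_lt_bound hp.le hp' one_pos (by norm_num)
    have hle := fun {m : ℕ} (hm : 0 < m) => scaledLpq_mono_exponent hp.le hm le_rfl hp.le hp'
    constructor
    · have hiff : ∀ N, IsN₁ p N ↔
          0 < N ∧ scaledLpq p p N < bound p ∧ bound p ≤ scaledLpq p p (N + 1) := fun N => by
        rw [IsN₁, scaledLp_eq_scaledLpq hp.le hp', scaledLp_eq_scaledLpq hp.le hp']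
      simp only [hiff]
      obtain ⟨N, hN⟩ := exists_crossing h1 ⟨n, hn, hbn.trans (hle hn)⟩
      -- Monotonicity in the size leaves room for only one crossing of the order p mean.
      have huniq : ∀ {a b : ℕ}, 0 < a → bound p ≤ scaledLpq p p (a + 1) →
          scaledLpq p p b < bound p → b ≤ a := fun {a b} ha h h' => by
        by_contra hab
        exact absurd (h.trans (scaledLpq_mono_size hp.le hp' hp.le hp' a.succ_pos
          (by omega : a + 1 ≤ b))) (not_le.2 h')
      exact ⟨N, hN, fun M hM => le_antisymm (huniq hN.1 hN.2.2 hM.2.1) (huniq hM.1 hM.2.2 hN.2.1)⟩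
    · obtain ⟨N, hN, h₁, h₂⟩ := exists_crossing ((hle one_pos).trans_lt h1) ⟨n, hn, hbn⟩
      exact ⟨N, hN, h₁.le, h₂⟩
  · have hlt₁ : ∀ (p : ℝ≥0∞) (n : ℕ), 1 < p → p < ENNReal.ofReal μ → 0 < n → n ≤ N₁ p →
        scaledLpq p p n < bound p := fun p n hp hpμ hn h => by
      have hp' := hne_top p hpμ
      have := (hN p hp hpμ).1.2.1
      rw [scaledLp_eq_scaledLpq hp.le hp'] at this
      exact (scaledLpq_mono_size hp.le hp' hp.le hp' hn h).trans_lt this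
    have hge₁ : ∀ (p : ℝ≥0∞) (n : ℕ), 1 < p → p < ENNReal.ofReal μ → N₁ p < n →
        bound p ≤ scaledLpq p p n := fun p n hp hpμ h => by
      have hp' := hne_top p hpμ
      have := (hN p hp hpμ).1.2.2
      rw [scaledLp_eq_scaledLpq hp.le hp'] at this
      exact this.trans (scaledLpq_mono_size hp.le hp' hp.le hp' (Nat.succ_pos _) h)
    have hseven : ∀ p : ℝ≥0∞, 1 < p → p < ENNReal.ofReal μ → 7 ≤ N₁ p := fun p hp hpμ => by
      by_contra! h
      exact absurd (hge₁ p 7 hp hpμ h)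
        (not_le.2 (scaledLpq_self_lt_bound hp.le (hne_top p hpμ) (by norm_num) le_rfl))
    have hη : ∀ (p : ℝ≥0∞) (n : ℕ), ∃ η : ℝ≥0∞,
        1 < p → p < ENNReal.ofReal μ → N₁ p < n → n ≤ N₂ p →
          1 ≤ η ∧ η ≤ p ∧ scaledLpq p η n = bound p ∧
            ∀ q : ℝ≥0∞, 1 ≤ q → scaledLpq p q n = bound p → q = η := fun p n => by
      by_cases h : 1 < p ∧ p < ENNReal.ofReal μ ∧ N₁ p < n ∧ n ≤ N₂ p
      · obtain ⟨hp, hpμ, hn₁, hn₂⟩ := h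
        have hp' := hne_top p hpμ
        have h7 := hseven p hp hpμ
        -- Any admissible `N₂ p` works: monotonicity in the size carries its upper estimate down to
        -- all `n ≤ N₂ p`.
        obtain ⟨η, hη⟩ := exists_unique_exponent hp.le hp' (show 3 ≤ n by omega)
          ((scaledLpq_mono_size hp.le hp' le_rfl ENNReal.one_ne_top (by omega) hn₂).trans
            (hN p hp hpμ).2.2.1) (hge₁ p n hp hpμ hn₁)
        exact ⟨η, fun _ _ _ _ => hη⟩
      -- Outside the intermediate range η is irrelevant and gets the value 1.
      · exact ⟨1, fun h1 h2 h3 h4 => absurd ⟨h1, h2, h3, h4⟩ h⟩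
    choose η hη using hη
    refine ⟨hseven, η, hη, fun n p q hn hq hqp => ⟨?_, fun h => ?_⟩⟩
    · rintro (⟨rfl, hn7⟩ | hpμ | ⟨hp, hpμ, hn₁⟩ | ⟨hp, hpμ, hn₁, hn₂, hqη⟩)
      · rw [le_antisymm hqp hq]
        exact scaledLpq_self_lt_bound le_rfl ENNReal.one_ne_top hn hn7
      · by_cases hp' : p = ∞
        · subst hp'
          exact scaledLpq_top_lt_bound hn hq
        · have hp : 1 < p := (by simpa using hμ1 : 1 < ENNReal.ofReal μ).trans_le hpμ
          exact scaledLpq_lt_bound_of_oddZeta_le hp hp' hn hq (ne_top_of_le_ne_top hp' hqp)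
            (habove p hp' hpμ)
      · exact (scaledLpq_mono_exponent hp.le hn hq hqp (hne_top p hpμ)).trans_lt
          (hlt₁ p n hp hpμ hn hn₁)
      · have h7 := hseven p hp hpμ
        rw [← (hη p n hp hpμ hn₁ hn₂).2.2.1]
        exact scaledLpq_strictMono_exponent hp.le (hne_top p hpμ) (by omega) hq hqη
    · simp only [not_or] at h
      obtain ⟨h1, h2, h3, h4⟩ := h
      have hpμ : p < ENNReal.ofReal μ := not_le.1 h2
      have hp' := hne_top p hpμ
      rcases (hq.trans hqp).eq_or_lt with rfl | hp
      · rw [le_antisymm hqp hq]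
        exact bound_one_le_scaledLpq (by by_contra hn8; exact h1 ⟨rfl, by omega⟩)
      · have hn₁ : N₁ p < n := by
          by_contra hle
          exact h3 ⟨hp, hpμ, by omega⟩
        by_cases hn₂ : n ≤ N₂ p
        · have hηq : η p n ≤ q := by
            by_contra hlt
            exact h4 ⟨hp, hpμ, hn₁, hn₂, not_le.1 hlt⟩
          obtain ⟨hη1, -, hηb, -⟩ := hη p n hp hpμ hn₁ hn₂
          rw [← hηb]
          exact scaledLpq_mono_exponent hp.le hn hη1 hηq (ne_top_of_le_ne_top hp' hqp)
        -- Beyond `N₂ p` the order 1 mean is already at least the bound, and a larger q only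
        -- increases it.
        · refine (hN p hp hpμ).2.2.2.trans ?_
          exact (scaledLpq_mono_size hp.le hp' le_rfl ENNReal.one_ne_top (Nat.succ_pos _)
            (by omega)).trans (scaledLpq_mono_exponent hp.le hn le_rfl hq
              (ne_top_of_le_ne_top hp' hqp))
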